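/- Let $(\Omega,\mathcal F,P)$ be a nonatomic probability space and $\lambda\in[0,1]$. For $Z\in L_1(\Omega,\mathcal F,P)$ put $$\rho(Z):=\mathbb E[Z]+\lambda\,\mathbb E\big[(Z-\mathbb E[Z])_+\big],\qquad \mathsf{AV@R}_\alpha(Z):=\inf_{t\in\mathbb R}\big\{t+(1-\alpha)^{-1}\mathbb E[(Z-t)_+]\big\}\quad(0\le\alpha<1).$$ Let $\mathfrak P$ be the set of Borel probability measures on $[0,1]$ having zero mass at $1$, with the weak topology of probability measures. A set $\mathfrak M\subset\mathfrak P$ is a Kusuoka set of $\rho$ if $\rho(Z)=\sup_{\mu\in\mathfrak M}\int_0^1\mathsf{AV@R}_\alpha(Z)\,d\mu(\alpha)$ for all $Z\in L_1(\Omega,\mathcal F,P)$; it is the minimal Kusuoka set if it is closed in $\mathfrak P$ and is contained in every Kusuoka set of $\rho$ that is closed in $\mathfrak P$. Then $\mathsf{AV@R}_0(Z)=\mathbb E[Z]$ and, for every $Z\in L_1(\Omega,\mathcal F,P)$, $$\rho(Z)=\sup_{\kappa\in[0,1]}\big\{(1-\lambda\kappa)\,\mathsf{AV@R}_0(Z)+\lambda\kappa\,\mathsf{AV@R}_{1-\kappa}(Z)\big\}$$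 (where for $\kappa=0$ the second term is $0$), and this representation is minimal: the set $$\mathfrak M:=\{(1-\lambda\kappa)\delta_0+\lambda\kappa\,\delta_{1-\kappa}:\kappa\in(0,1)\}$$ is a Kusuoka set of $\rho$, its closure in $\mathfrak P$ is $\{(1-\lambda\kappa)\delta_0+\lambda\kappa\,\delta_{1-\kappa}:\kappa\in[0,1]\}$ (the measure for $\kappa=0$ being $\delta_0$), and this closure is the minimal Kusuoka set of $\rho$. -/

import Mathlib

open MeasureTheory

noncomputable section

namespace Kusuoka

/-- A measure is nonatomic if every measurable set of positive measure has a measurable subset of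
strictly smaller positive measure. On general measurable spaces this is stronger than asking that
points be null. -/
def Nonatomic {Ω : Type*} [MeasurableSpace Ω] (P : Measure Ω) : Prop :=
  ∀ A : Set Ω, MeasurableSet A → 0 < P A →
    ∃ B : Set Ω, B ⊆ A ∧ MeasurableSet B ∧ 0 < P B ∧ P B < P A

/-- The (upper) Average Value-at-Risk `inf_t { t + (1 - α)⁻¹ E[Z - t]₊ }` at level `α ∈ [0,1)`.
The value at `α = 1` is a junk value: it only ever occurs with weight zero below. -/
def avar {Ω : Type*} [MeasurableSpace Ω] (P : Measure Ω) (α : ℝ) (Z : Ω → ℝ) : ℝ :=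
  ⨅ t : ℝ, (t + (1 - α)⁻¹ * ∫ ω, max (Z ω - t) 0 ∂P)

/-- The absolute semideviation `E Z + lam * E (Z - E Z)₊`. -/
def absSemidev {Ω : Type*} [MeasurableSpace Ω] (P : Measure Ω) (lam : ℝ) (Z : Ω → ℝ) : ℝ :=
  (∫ ω, Z ω ∂P) + lam * ∫ ω, max (Z ω - ∫ ω', Z ω' ∂P) 0 ∂P

/-- The space of probability measures on `[0,1]` having zero mass at `1`, with the (subspace
topology of the) weak topology of probability measures. -/
abbrev ProbZeroAtOne : Type :=
  {μ : ProbabilityMeasure unitInterval // (μ : Measure unitInterval) {1} = 0}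

/-- A set `M` of probability measures on `[0,1]` having zero mass at `1` is a Kusuoka set of the
functional `ρ` on `L₁(P)` if `ρ Z = sup_{μ ∈ M} ∫ AV@R_α(Z) dμ(α)` for every `Z ∈ L₁(P)`.
As `AV@R_α(Z) ≥ E Z`, the integrals are well defined in `(-∞, ∞]`; since `ρ Z` is real, the
representation includes that they are all finite. -/
def IsKusuokaSet {Ω : Type*} [MeasurableSpace Ω] (P : Measure Ω) (ρ : (Ω → ℝ) → ℝ)
    (M : Set ProbZeroAtOne) : Prop :=
  ∀ Z : Ω → ℝ, Integrable Z P →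
    (∀ μ ∈ M, Integrable (fun α : unitInterval => avar P α Z)
      (μ.1 : Measure unitInterval)) ∧
    IsLUB ((fun μ : ProbZeroAtOne =>
      ∫ α : unitInterval, avar P α Z ∂(μ.1 : Measure unitInterval)) '' M) (ρ Z)

/-- The minimal Kusuoka set: a closed Kusuoka set contained in every closed Kusuoka set. -/
def IsMinimalKusuokaSet {Ω : Type*} [MeasurableSpace Ω] (P : Measure Ω) (ρ : (Ω → ℝ) → ℝ)
    (M : Set ProbZeroAtOne) : Prop :=
  IsClosed M ∧ IsKusuokaSet P ρ M ∧
    ∀ M' : Set ProbZeroAtOne, IsClosed M' → IsKusuokaSet P ρ M' → M ⊆ M'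

/-- The measure `(1 - lam * κ) δ₀ + lam * κ δ_{1-κ}` on `[0,1]`. -/
def mixMeasure (lam κ : unitInterval) : Measure unitInterval :=
  ENNReal.ofReal (1 - lam * κ) • Measure.dirac 0 +
    ENNReal.ofReal (lam * κ) • Measure.dirac (unitInterval.symm κ)

theorem mixMeasure_univ (lam κ : unitInterval) : mixMeasure lam κ Set.univ = 1 := by
  have h0 : (0 : ℝ) ≤ lam * κ := mul_nonneg lam.2.1 κ.2.1
  have h1 : (lam : ℝ) * κ ≤ 1 := mul_le_one₀ lam.2.2 κ.2.1 κ.2.2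
  simp only [mixMeasure, Measure.add_apply, Measure.smul_apply, measure_univ, smul_eq_mul, mul_one]
  rw [← ENNReal.ofReal_add (sub_nonneg.2 h1) h0]
  simp

theorem mixMeasure_one (lam κ : unitInterval) : mixMeasure lam κ {1} = 0 := by
  by_cases hκ : κ = 0
  · subst hκ
    simp [mixMeasure]
  · have h : unitInterval.symm κ ≠ 1 := fun h => hκ (by simpa using congrArg unitInterval.symm h)
    simp [mixMeasure, h]

/-- The measure `(1 - lam * κ) δ₀ + lam * κ δ_{1-κ}` as a probability measure with no mass
at `1`. -/
def mix (lam κ : unitInterval) : ProbZeroAtOne :=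
  ⟨⟨mixMeasure lam κ, ⟨mixMeasure_univ lam κ⟩⟩, mixMeasure_one lam κ⟩

end Kusuoka

end

/-! Taking `t = E Z` in the infimum gives `κ AV@R_{1-κ}(Z) ≤ κ E Z + E(Z - E Z)₊`, with equality at
`κ = P(Z > E Z)`, which lies in `(0,1)` unless `Z` is a.s. constant. So the supremum is attained at
an interior `κ`, and since `mix lam` is continuous on a compact interval, the closure of the
interior family is its range.

Minimality tests an arbitrary Kusuoka set on two kinds of variables, which exist by nonatomicity.
Differences of indicators of small events show that each of its measures gives `(1 - α)⁻¹` on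
`(0,1)` integral at most `lam` (`IsKusuokaSet.weight_bound`). Given this bound, near-optimality for
the indicator of an event of probability `κ` forces the weighted measure to concentrate at `1 - κ`
with mass near `lam` (`tendsto_mix`). Every `mix lam κ` with `0 < κ < 1` is thus a limit of members
of the set (`IsKusuokaSet.mix_mem_closure`). -/

noncomputable section
namespace Kusuoka

open Filter Topology

/-! ### Intermediate values of nonatomic measures -/

section Nonatomic

variable {Ω : Type*} [MeasurableSpace Ω] {P : Measure Ω} [IsFiniteMeasure P]

/-- Nonatomicity splits a set into two pieces of positive measure, and the smaller has at most half
the measure; iterate. -/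
theorem Nonatomic.exists_subset_real_le (hP : Nonatomic P) {S : Set Ω} (hS : MeasurableSet S)
    (h0 : 0 < P.real S) (n : ℕ) :
    ∃ B ⊆ S, MeasurableSet B ∧ 0 < P.real B ∧ P.real B ≤ P.real S / 2 ^ n := by
  induction n with
  | zero => exact ⟨S, subset_rfl, hS, h0, by simp⟩
  | succ n ih =>
    obtain ⟨B, hBS, hB, hB0, hBn⟩ := ih
    obtain ⟨C, hCB, hC, hC0, hCl⟩ := hP B hB (by
      rw [measureReal_def] at hB0; exact (ENNReal.toReal_pos_iff.1 hB0).1)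
    have hC0' : 0 < P.real C := ENNReal.toReal_pos hC0.ne' (measure_ne_top _ _)
    have hCl' : P.real C < P.real B :=
      (ENNReal.toReal_lt_toReal (measure_ne_top _ _) (measure_ne_top _ _)).2 hCl
    have hdiff : P.real (B \ C) = P.real B - P.real C := measureReal_sdiff hCB hC
    have hhalf : P.real S / 2 ^ (n + 1) = P.real S / 2 ^ n / 2 := by rw [pow_succ]; field_simp
    rcases le_total (P.real C) (P.real B / 2) with h | h
    · exact ⟨C, hCB.trans hBS, hC, hC0', by rw [hhalf]; linarith⟩
    · exact ⟨B \ C, Set.sdiff_subset.trans hBS, hB.diff hC, by linarith, by rw [hhalf]; linarith⟩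

/-- Sierpiński's theorem: a nonatomic finite measure takes all intermediate values. -/
theorem Nonatomic.exists_subset_real_eq (hP : Nonatomic P) {S : Set Ω} (hS : MeasurableSet S)
    {c : ℝ} (hc0 : 0 ≤ c) (hc : c ≤ P.real S) :
    ∃ A ⊆ S, MeasurableSet A ∧ P.real A = c := by
  let T : Type _ := {A : Set Ω // A ⊆ S ∧ MeasurableSet A ∧ P.real A ≤ c}
  -- Greedy choice: `A'` comes within `1/(n+1)` of the largest measure of any admissible extension
  -- of `A`.
  have step : ∀ (n : ℕ) (A : T), ∃ A' : T, A.1 ⊆ A'.1 ∧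
      ∀ D : T, A.1 ⊆ D.1 → P.real D.1 ≤ P.real A'.1 + 1 / ((n : ℝ) + 1) := by
    intro n A
    by_contra! h
    have hn : 0 < 1 / ((n : ℝ) + 1) := by positivity
    let V : Set ℝ := (fun D : T => P.real D.1) '' {D | A.1 ⊆ D.1}
    have hVne : V.Nonempty := ⟨_, A, Set.Subset.refl _, rfl⟩
    have hVb : BddAbove V := ⟨c, by rintro _ ⟨D, -, rfl⟩; exact D.2.2.2⟩
    obtain ⟨_, ⟨D, hD, rfl⟩, hlt⟩ := exists_lt_of_lt_csSup hVne (sub_lt_self (sSup V) hn)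
    obtain ⟨E, hE, hlt'⟩ := h D hD
    have := le_csSup hVb ⟨E, hE, rfl⟩
    simp only at hlt this
    linarith
  choose next hnext hmax using step
  let A : ℕ → T := fun n => Nat.rec ⟨∅, Set.empty_subset _, MeasurableSet.empty, by simpa⟩ next n
  have hmono : Monotone fun n => (A n).1 := monotone_nat_of_le_succ fun n => hnext n (A n)
  let U : Set Ω := ⋃ n, (A n).1
  have hU : MeasurableSet U := MeasurableSet.iUnion fun n => (A n).2.2.1
  have hUS : U ⊆ S := Set.iUnion_subset fun n => (A n).2.1
  have hUc : P.real U ≤ c := by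
    have h := (ENNReal.tendsto_toReal (measure_ne_top P U)).comp
      (tendsto_measure_iUnion_atTop (μ := P) hmono)
    exact le_of_tendsto' h fun n => (A n).2.2.2
  refine ⟨U, hUS, hU, hUc.antisymm ?_⟩
  by_contra! hlt
  have hdiff : P.real (S \ U) = P.real S - P.real U := measureReal_sdiff hUS hU
  obtain ⟨n, hn⟩ := exists_nat_gt (P.real (S \ U) / (c - P.real U))
  obtain ⟨B, hBS, hB, hB0, hBn⟩ := hP.exists_subset_real_le (hS.diff hU) (by linarith) n
  have hBc : P.real B ≤ c - P.real U := by
    refine hBn.trans ?_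
    have h2 : (n : ℝ) < 2 ^ n := by exact_mod_cast Nat.lt_two_pow_self
    rw [div_lt_iff₀ (by linarith)] at hn
    rw [div_le_iff₀ (by positivity)]
    nlinarith
  have hdisj : Disjoint U B := Set.disjoint_left.2 fun x hx hxB => (hBS hxB).2 hx
  have hUB : P.real (U ∪ B) = P.real U + P.real B := measureReal_union hdisj hB
  let D : T := ⟨U ∪ B, Set.union_subset hUS (hBS.trans Set.sdiff_subset), hU.union hB,
    by linarith⟩
  -- `U ∪ B` competes at every greedy stage, so adding `B` can gain at most `1/(m+1)`; this fails
  -- once `1/(m+1) < P.real B`.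
  obtain ⟨m, hm⟩ := exists_nat_one_div_lt hB0
  have h1 := hmax m (A m) D ((Set.subset_iUnion (fun n => (A n).1) m).trans Set.subset_union_left)
  have h2 : P.real (A (m + 1)).1 ≤ P.real U :=
    measureReal_mono (Set.subset_iUnion (fun n => (A n).1) (m + 1))
  change P.real (U ∪ B) ≤ P.real (A (m + 1)).1 + _ at h1
  linarith

end Nonatomic

/-! ### AV@R and the supremum formula -/

section Avar

variable {Ω : Type*} [MeasurableSpace Ω] {P : Measure Ω} [IsProbabilityMeasure P]
  {Z : Ω → ℝ} {α : ℝ}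

theorem integrable_max_sub (hZ : Integrable Z P) (t : ℝ) :
    Integrable (fun ω => max (Z ω - t) 0) P :=
  (hZ.sub (integrable_const t)).pos_part

theorem integral_sub_le (hZ : Integrable Z P) (t : ℝ) :
    (∫ ω, Z ω ∂P) - t ≤ ∫ ω, max (Z ω - t) 0 ∂P := by
  have h : ∫ ω, (Z ω - t) ∂P = (∫ ω, Z ω ∂P) - t := by
    rw [integral_sub hZ (integrable_const t)]; simp
  rw [← h]
  exact integral_mono (hZ.sub (integrable_const t)) (integrable_max_sub hZ t) fun ω => le_max_left _ _

theorem integral_le_add_integral_max (hZ : Integrable Z P) (h0 : 0 ≤ α) (h1 : α < 1) (t : ℝ) :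
    ∫ ω, Z ω ∂P ≤ t + (1 - α)⁻¹ * ∫ ω, max (Z ω - t) 0 ∂P := by
  have hc : 1 ≤ (1 - α)⁻¹ := (one_le_inv₀ (by linarith)).2 (by linarith)
  have hI : 0 ≤ ∫ ω, max (Z ω - t) 0 ∂P := integral_nonneg fun ω => le_max_right _ _
  nlinarith [integral_sub_le hZ t]

theorem integral_le_avar (hZ : Integrable Z P) (h0 : 0 ≤ α) (h1 : α < 1) :
    ∫ ω, Z ω ∂P ≤ avar P α Z :=
  le_ciInf (integral_le_add_integral_max hZ h0 h1)

theorem avar_le (hZ : Integrable Z P) (h0 : 0 ≤ α) (h1 : α < 1) (t : ℝ) :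
    avar P α Z ≤ t + (1 - α)⁻¹ * ∫ ω, max (Z ω - t) 0 ∂P :=
  ciInf_le ⟨_, Set.forall_mem_range.2 (integral_le_add_integral_max hZ h0 h1)⟩ t

/-- At level `0` the objective is `E max(Z, t)`, which tends to `E Z` as `t → -∞`. -/
theorem avar_zero (hZ : Integrable Z P) : avar P 0 Z = ∫ ω, Z ω ∂P := by
  refine le_antisymm ?_ (integral_le_avar hZ le_rfl one_pos)
  have key : Tendsto (fun t : ℝ => ∫ ω, max (Z ω) t ∂P) atBot (𝓝 (∫ ω, Z ω ∂P)) := by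
    refine tendsto_integral_filter_of_dominated_convergence (fun ω => |Z ω|)
      (Eventually.of_forall fun t =>
        hZ.aestronglyMeasurable.sup aestronglyMeasurable_const) ?_ hZ.abs ?_
    · filter_upwards [eventually_le_atBot (0 : ℝ)] with t ht
      refine Eventually.of_forall fun ω => ?_
      rw [Real.norm_eq_abs, abs_le]
      exact ⟨(neg_abs_le _).trans (le_max_left _ _),
        max_le (le_abs_self _) (ht.trans (abs_nonneg _))⟩
    · refine Eventually.of_forall fun ω => tendsto_const_nhds.congr' ?_
      filter_upwards [eventually_le_atBot (Z ω)] with t ht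
      exact (max_eq_left ht).symm
  refine ge_of_tendsto' key fun t => ?_
  refine (avar_le hZ le_rfl one_pos t).trans_eq ?_
  have h : ∫ ω, max (Z ω) t ∂P = ∫ ω, (t + max (Z ω - t) 0) ∂P := by
    refine integral_congr_ae (Eventually.of_forall fun ω => ?_)
    simp only
    rw [add_comm, ← max_add_add_right]; simp
  rw [h, integral_add (integrable_const t) (integrable_max_sub hZ t)]
  simp

/-- Use `t = E Z`. The factor `κ` cancels `(1 - α)⁻¹` and, at `κ = 0`, removes the junk value of
`avar` at level `1`. -/
theorem mul_avar_le (hZ : Integrable Z P) (κ : unitInterval) :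
    (κ : ℝ) * avar P (1 - κ) Z ≤
      κ * (∫ ω, Z ω ∂P) + ∫ ω, max (Z ω - ∫ ω', Z ω' ∂P) 0 ∂P := by
  have hI : 0 ≤ ∫ ω, max (Z ω - ∫ ω', Z ω' ∂P) 0 ∂P := integral_nonneg fun ω => le_max_right _ _
  rcases κ.2.1.eq_or_lt with h | h
  · rw [← h]; simpa using hI
  · have := avar_le hZ (α := 1 - κ) (by linarith [κ.2.2]) (by linarith) (∫ ω, Z ω ∂P)
    rw [sub_sub_cancel] at this
    calc (κ : ℝ) * avar P (1 - κ) Z ≤ κ * _ := mul_le_mul_of_nonneg_left this h.le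
      _ = _ := by field_simp

theorem mix_value_le (hZ : Integrable Z P) (lam κ : unitInterval) :
    (1 - (lam : ℝ) * κ) * avar P 0 Z + lam * κ * avar P (1 - κ) Z ≤ absSemidev P lam Z := by
  rw [avar_zero hZ, absSemidev]
  nlinarith [mul_le_mul_of_nonneg_left (mul_avar_le hZ κ) lam.2.1]

/-- The inequality reverse to `mul_avar_le` at some interior level. -/
theorem exists_le_mul_avar (hZ : Integrable Z P) : ∃ κ ∈ Set.Ioo (0 : unitInterval) 1,
    (κ : ℝ) * (∫ ω, Z ω ∂P) + ∫ ω, max (Z ω - ∫ ω', Z ω' ∂P) 0 ∂P ≤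
      (κ : ℝ) * avar P (1 - κ) Z := by
  set m := ∫ ω, Z ω ∂P with hm
  have hZm : Integrable (fun ω => Z ω - m) P := hZ.sub (integrable_const m)
  have hZm0 : ∫ ω, (Z ω - m) ∂P = 0 := by
    rw [integral_sub hZ (integrable_const m)]; simp [hm]
  rcases (integral_nonneg fun ω => le_max_right (Z ω - m) 0 :
    0 ≤ ∫ ω, max (Z ω - m) 0 ∂P).eq_or_lt with h | hpos
  -- With zero semideviation any interior level works, because `avar` dominates the mean.
  · refine ⟨⟨1 / 2, by norm_num, by norm_num⟩, ⟨?_, ?_⟩, ?_⟩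
    · rw [← Subtype.coe_lt_coe]; norm_num
    · rw [← Subtype.coe_lt_coe]; norm_num
    · rw [← h]
      have := integral_le_avar hZ (α := 1 - 1 / 2) (by norm_num) (by norm_num)
      simp only
      linarith
  have hnull : NullMeasurableSet {ω | m < Z ω} P :=
    nullMeasurableSet_lt aemeasurable_const hZ.aemeasurable
  obtain ⟨S, hSsub, hS, hSae⟩ := hnull.exists_measurable_superset_ae_eq
  have hmax : (fun ω => max (Z ω - m) 0) =ᵐ[P] S.indicator fun ω => Z ω - m := by
    filter_upwards [hSae] with ω hω
    have hω' : ω ∈ S ↔ m < Z ω := iff_of_eq hω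
    by_cases h : ω ∈ S
    · rw [Set.indicator_of_mem h, max_eq_left (by linarith [hω'.1 h])]
    · rw [Set.indicator_of_notMem h, max_eq_right]
      have : ¬ m < Z ω := fun h' => h (hω'.2 h')
      linarith
  have hI : ∫ ω, max (Z ω - m) 0 ∂P = ∫ ω in S, (Z ω - m) ∂P := by
    rw [integral_congr_ae hmax, integral_indicator hS]
  have hκ0 : 0 < P.real S := by
    refine measureReal_nonneg.lt_of_ne' fun h => ?_
    have : P S = 0 := (measureReal_eq_zero_iff).1 h
    rw [hI, setIntegral_measure_zero _ this] at hpos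
    exact lt_irrefl _ hpos
  have hκ1 : P.real S < 1 := by
    refine measureReal_le_one.lt_of_ne fun h => ?_
    have hc : P.real Sᶜ = 0 := by rw [measureReal_compl hS]; simp [h]
    have : ∫ ω in Sᶜ, (Z ω - m) ∂P = 0 :=
      setIntegral_measure_zero _ ((measureReal_eq_zero_iff).1 hc)
    have hadd := integral_add_compl hS hZm
    linarith
  refine ⟨⟨P.real S, hκ0.le, hκ1.le⟩, ⟨?_, ?_⟩, ?_⟩
  · rw [← Subtype.coe_lt_coe]; simpa
  · rw [← Subtype.coe_lt_coe]; simpa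
  simp only
  -- `E(Z - t)₊ ≥ ∫_S (Z - t)` makes the objective at least `(P.real S)⁻¹ ∫_S Z` for every `t`.
  have key : m + (P.real S)⁻¹ * ∫ ω, max (Z ω - m) 0 ∂P ≤ avar P (1 - P.real S) Z := by
    refine le_ciInf fun t => ?_
    rw [sub_sub_cancel]
    have h1 : ∫ ω in S, (Z ω - t) ∂P ≤ ∫ ω, max (Z ω - t) 0 ∂P :=
      calc ∫ ω in S, (Z ω - t) ∂P ≤ ∫ ω in S, max (Z ω - t) 0 ∂P :=
            integral_mono (hZ.sub (integrable_const t)).integrableOn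
              (integrable_max_sub hZ t).integrableOn fun ω => le_max_left _ _
        _ ≤ _ := setIntegral_le_integral (integrable_max_sub hZ t)
              (Eventually.of_forall fun ω => le_max_right _ _)
    have h2 : ∀ s : ℝ, ∫ ω in S, (Z ω - s) ∂P = (∫ ω in S, Z ω ∂P) - P.real S * s := by
      intro s
      rw [integral_sub hZ.integrableOn (integrable_const s).integrableOn]
      simp
    rw [hI, h2 m]
    rw [h2 t] at h1
    have h3 := mul_le_mul_of_nonneg_left h1 (inv_nonneg.2 hκ0.le)
    rw [mul_sub, inv_mul_cancel_left₀ hκ0.ne'] at h3 ⊢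
    linarith
  have h3 := mul_le_mul_of_nonneg_left key hκ0.le
  rwa [mul_add, mul_inv_cancel_left₀ hκ0.ne'] at h3

theorem exists_mix_value_eq (hZ : Integrable Z P) (lam : unitInterval) :
    ∃ κ ∈ Set.Ioo (0 : unitInterval) 1,
      (1 - (lam : ℝ) * κ) * avar P 0 Z + lam * κ * avar P (1 - κ) Z = absSemidev P lam Z := by
  obtain ⟨κ, hκ, h⟩ := exists_le_mul_avar hZ
  refine ⟨κ, hκ, (mix_value_le hZ lam κ).antisymm ?_⟩
  rw [avar_zero hZ, absSemidev]
  nlinarith [mul_le_mul_of_nonneg_left h lam.2.1]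

theorem isLUB_mix_value (hZ : Integrable Z P) (lam : unitInterval) {S : Set unitInterval}
    (hS : Set.Ioo 0 1 ⊆ S) :
    IsLUB ((fun κ : unitInterval =>
      (1 - (lam : ℝ) * κ) * avar P 0 Z + lam * κ * avar P (1 - κ) Z) '' S)
      (absSemidev P lam Z) := by
  obtain ⟨κ, hκ, h⟩ := exists_mix_value_eq hZ lam
  refine IsGreatest.isLUB ⟨⟨κ, hS hκ, h⟩, ?_⟩
  rintro _ ⟨κ', -, rfl⟩
  exact mix_value_le hZ lam κ'

end Avar

/-! ### The curve of two-point mixtures -/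

section Mix

theorem integrable_mixMeasure (lam κ : unitInterval) (g : unitInterval → ℝ) :
    Integrable g (mixMeasure lam κ) :=
  ((integrable_dirac (by simp)).smul_measure ENNReal.ofReal_ne_top).add_measure
    ((integrable_dirac (by simp)).smul_measure ENNReal.ofReal_ne_top)

theorem integral_mixMeasure (lam κ : unitInterval) (g : unitInterval → ℝ) :
    ∫ α, g α ∂(mixMeasure lam κ) =
      (1 - (lam : ℝ) * κ) * g 0 + lam * κ * g (unitInterval.symm κ) := by
  have h0 : (0 : ℝ) ≤ lam * κ := mul_nonneg lam.2.1 κ.2.1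
  have h1 : (lam : ℝ) * κ ≤ 1 := mul_le_one₀ lam.2.2 κ.2.1 κ.2.2
  rw [mixMeasure, integral_add_measure
    ((integrable_dirac (by simp)).smul_measure ENNReal.ofReal_ne_top)
    ((integrable_dirac (by simp)).smul_measure ENNReal.ofReal_ne_top),
    integral_smul_measure, integral_smul_measure, integral_dirac, integral_dirac,
    ENNReal.toReal_ofReal (sub_nonneg.2 h1), ENNReal.toReal_ofReal h0, smul_eq_mul, smul_eq_mul]

theorem isKusuokaSet_image_mix {Ω : Type*} [MeasurableSpace Ω] (P : Measure Ω)
    [IsProbabilityMeasure P] (lam : unitInterval) {S : Set unitInterval}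
    (hS : Set.Ioo 0 1 ⊆ S) : IsKusuokaSet P (absSemidev P lam) (mix lam '' S) := by
  intro Z hZ
  refine ⟨?_, ?_⟩
  · rintro _ ⟨κ, -, rfl⟩
    exact integrable_mixMeasure lam κ _
  · rw [Set.image_image]
    convert isLUB_mix_value hZ lam hS using 2
    refine (integral_mixMeasure lam _ _).trans ?_
    simp

theorem continuous_mix (lam : unitInterval) : Continuous (mix lam) := by
  have hp : Continuous fun κ => (mix lam κ).1 := by
    rw [ProbabilityMeasure.continuous_iff_forall_continuous_integral]
    intro f
    have h : ∀ κ, ∫ α, f α ∂(mixMeasure lam κ) = _ := fun κ => integral_mixMeasure lam κ f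
    refine Continuous.congr (f := fun κ : unitInterval =>
      (1 - (lam : ℝ) * κ) * f 0 + lam * κ * f (unitInterval.symm κ)) ?_ fun κ => (h κ).symm
    have := f.continuous
    fun_prop
  exact hp.subtype_mk _

theorem closure_Ioo_unitInterval : closure (Set.Ioo (0 : unitInterval) 1) = Set.univ := by
  rw [closure_Ioo zero_ne_one]
  exact Set.eq_univ_of_forall fun x => ⟨unitInterval.nonneg', unitInterval.le_one'⟩

theorem closure_image_mix (lam : unitInterval) :
    closure (mix lam '' Set.Ioo 0 1) = Set.range (mix lam) := by
  refine Set.Subset.antisymm ?_ ?_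
  · exact closure_minimal (Set.image_subset_range _ _)
      (isCompact_range (continuous_mix lam)).isClosed
  · rw [← Set.image_univ, ← closure_Ioo_unitInterval]
    exact image_closure_subset_closure_image (continuous_mix lam)

end Mix

/-! ### Test variables -/

section TestFunctions

variable {Ω : Type*} [MeasurableSpace Ω] {P : Measure Ω} [IsProbabilityMeasure P]

/-- Test function for the spread of a spectrum: the difference of the indicators of two disjoint
events of probability `ε`. -/
theorem Nonatomic.exists_spread (hP : Nonatomic P) (lam : ℝ) {ε : ℝ} (h0 : 0 < ε)
    (h1 : ε < 1 / 2) :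
    ∃ Z : Ω → ℝ, Integrable Z P ∧ ∫ ω, Z ω ∂P = 0 ∧ absSemidev P lam Z = lam * ε ∧
      ∀ α : ℝ, ε ≤ α → α ≤ 1 - ε → ε * (1 - α)⁻¹ ≤ avar P α Z := by
  obtain ⟨A, -, hA, hPA⟩ := hP.exists_subset_real_eq MeasurableSet.univ h0.le
    (by simp only [probReal_univ]; linarith)
  have hAc : P.real Aᶜ = 1 - ε := by rw [measureReal_compl hA, hPA, probReal_univ]
  obtain ⟨B, hBA, hB, hPB⟩ := hP.exists_subset_real_eq hA.compl h0.le (by rw [hAc]; linarith)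
  have hiA : Integrable (A.indicator fun _ => (1 : ℝ)) P := (integrable_const _).indicator hA
  have hiB : Integrable (B.indicator fun _ => (1 : ℝ)) P := (integrable_const _).indicator hB
  have hIA : ∫ ω, A.indicator (fun _ => (1 : ℝ)) ω ∂P = ε := by
    rw [integral_indicator hA]; simpa using hPA
  have hIB : ∫ ω, B.indicator (fun _ => (1 : ℝ)) ω ∂P = ε := by
    rw [integral_indicator hB]; simpa using hPB
  have hZ : Integrable
      (fun ω => A.indicator (fun _ => (1 : ℝ)) ω - B.indicator (fun _ => (1 : ℝ)) ω) P :=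
    hiA.sub hiB
  have hcases : ∀ ω,
      (A.indicator (fun _ => (1 : ℝ)) ω = 1 ∧ B.indicator (fun _ => (1 : ℝ)) ω = 0) ∨
      (A.indicator (fun _ => (1 : ℝ)) ω = 0 ∧ B.indicator (fun _ => (1 : ℝ)) ω = 1) ∨
      (A.indicator (fun _ => (1 : ℝ)) ω = 0 ∧ B.indicator (fun _ => (1 : ℝ)) ω = 0) := by
    intro ω
    by_cases hωA : ω ∈ A
    · have : ω ∉ B := fun h => hBA h hωA
      simp [hωA, this]
    · by_cases hωB : ω ∈ B <;> simp [hωA, hωB]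
  have hmean : ∫ ω, (A.indicator (fun _ => (1 : ℝ)) ω - B.indicator (fun _ => (1 : ℝ)) ω) ∂P
      = 0 := by
    rw [integral_sub hiA hiB, hIA, hIB, sub_self]
  refine ⟨_, hZ, hmean, ?_, ?_⟩
  · rw [absSemidev, hmean, zero_add]
    congr 1
    rw [← hIA]
    refine integral_congr_ae (Eventually.of_forall fun ω => ?_)
    rcases hcases ω with ⟨h, h'⟩ | ⟨h, h'⟩ | ⟨h, h'⟩ <;> simp [h, h']
  · intro α hα hα'
    refine le_ciInf fun t => ?_
    -- Duality: `ψ = 1` on `A`, `0` on `B`, `θ` elsewhere has `0 ≤ ψ ≤ 1`, and `θ` is chosen so that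
    -- `E ψ = 1 - α`. The minorant of `(Z - t)₊` integrated below is `ψ (Z - t)`.
    set θ : ℝ := (1 - α - ε) / (1 - 2 * ε) with hθ
    have hθ0 : 0 ≤ θ := div_nonneg (by linarith) (by linarith)
    have hθ1 : θ ≤ 1 := (div_le_one (by linarith)).2 (by linarith)
    have hθe : θ * (1 - 2 * ε) = 1 - α - ε := div_mul_cancel₀ _ (by linarith)
    have hlin : ∫ ω, ((1 - t + θ * t) * A.indicator (fun _ => (1 : ℝ)) ω
        + (θ * t) * B.indicator (fun _ => (1 : ℝ)) ω + (- (θ * t))) ∂P = ε - (1 - α) * t := by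
      rw [integral_add
          (f := fun ω => (1 - t + θ * t) * A.indicator (fun _ => (1 : ℝ)) ω
            + (θ * t) * B.indicator (fun _ => (1 : ℝ)) ω)
          ((hiA.const_mul _).add (hiB.const_mul _)) (integrable_const _),
        integral_add (hiA.const_mul _) (hiB.const_mul _), integral_const_mul, integral_const_mul,
        hIA, hIB]
      simp only [integral_const, probReal_univ, smul_eq_mul]
      linear_combination (-t) * hθe
    have hle : ε - (1 - α) * t ≤ ∫ ω, max (A.indicator (fun _ => (1 : ℝ)) ω
        - B.indicator (fun _ => (1 : ℝ)) ω - t) 0 ∂P := by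
      rw [← hlin]
      refine integral_mono (((hiA.const_mul _).add (hiB.const_mul _)).add (integrable_const _))
        (integrable_max_sub hZ t) fun ω => ?_
      rcases hcases ω with ⟨h, h'⟩ | ⟨h, h'⟩ | ⟨h, h'⟩ <;> simp only [h, h']
      · refine le_trans (le_of_eq ?_) (le_max_left _ _); ring
      · refine le_trans (le_of_eq ?_) (le_max_right _ _); ring
      · rcases le_total t 0 with ht | ht
        · refine le_trans ?_ (le_max_left _ _); nlinarith
        · refine le_trans ?_ (le_max_right _ _); nlinarith
    have hα1 : 0 < 1 - α := by linarith
    have := mul_le_mul_of_nonneg_left hle (inv_nonneg.2 hα1.le)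
    rw [mul_sub, inv_mul_cancel_left₀ hα1.ne'] at this
    linarith

/-- `Z` is the indicator of an event of probability `κ`; the two bounds come from `t = 1` and `t =
0`. -/
theorem Nonatomic.exists_indicator (hP : Nonatomic P) (lam : ℝ) {κ : ℝ} (h0 : 0 < κ)
    (h1 : κ < 1) :
    ∃ Z : Ω → ℝ, Integrable Z P ∧ absSemidev P lam Z = κ + lam * (κ * (1 - κ)) ∧
      ∀ α : ℝ, 0 ≤ α → α < 1 → avar P α Z ≤ 1 ∧ avar P α Z ≤ (1 - α)⁻¹ * κ := by
  obtain ⟨A, -, hA, hPA⟩ := hP.exists_subset_real_eq MeasurableSet.univ h0.le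
    (by simp only [probReal_univ]; linarith)
  have hi : Integrable (A.indicator fun _ => (1 : ℝ)) P := (integrable_const _).indicator hA
  have hI : ∫ ω, A.indicator (fun _ => (1 : ℝ)) ω ∂P = κ := by
    rw [integral_indicator hA]; simpa using hPA
  have hind : ∀ ω, A.indicator (fun _ => (1 : ℝ)) ω = 1 ∨ A.indicator (fun _ => (1 : ℝ)) ω = 0 := by
    intro ω
    by_cases h : ω ∈ A <;> simp [h]
  refine ⟨_, hi, ?_, fun α hα0 hα1 => ⟨?_, ?_⟩⟩
  · rw [absSemidev, hI]
    congr 2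
    calc ∫ ω, max (A.indicator (fun _ => (1 : ℝ)) ω - κ) 0 ∂P
        = ∫ ω, A.indicator (fun _ => (1 : ℝ)) ω * (1 - κ) ∂P := by
          refine integral_congr_ae (Eventually.of_forall fun ω => ?_)
          rcases hind ω with h | h <;> simp [h, h0.le, h1.le]
      _ = κ * (1 - κ) := by rw [integral_mul_const, hI]
  · refine (avar_le hi hα0 hα1 1).trans_eq ?_
    have : ∫ ω, max (A.indicator (fun _ => (1 : ℝ)) ω - 1) 0 ∂P = ∫ _, (0 : ℝ) ∂P := by
      refine integral_congr_ae (Eventually.of_forall fun ω => ?_)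
      rcases hind ω with h | h <;> simp [h]
    rw [this]; simp
  · refine (avar_le hi hα0 hα1 0).trans_eq ?_
    have : ∫ ω, max (A.indicator (fun _ => (1 : ℝ)) ω - 0) 0 ∂P = κ := by
      rw [← hI]
      refine integral_congr_ae (Eventually.of_forall fun ω => ?_)
      rcases hind ω with h | h <;> simp [h]
    rw [this, zero_add]

end TestFunctions

/-! ### The weighted mass bound -/

section Weight

/-- The density `(1 - α)⁻¹` on `(0,1)`, extended by zero. -/
def weight (α : unitInterval) : ℝ := if α = 0 then 0 else (1 - (α : ℝ))⁻¹

theorem weight_zero : weight 0 = 0 := if_pos rfl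

theorem weight_of_ne {α : unitInterval} (h : α ≠ 0) : weight α = (1 - (α : ℝ))⁻¹ := if_neg h

theorem weight_nonneg (α : unitInterval) : 0 ≤ weight α := by
  rw [weight]
  split_ifs
  exacts [le_rfl, inv_nonneg.2 (sub_nonneg.2 α.2.2)]

theorem measurable_weight : Measurable weight :=
  Measurable.ite (measurableSet_singleton 0) measurable_const
    (measurable_const.sub measurable_subtype_coe).inv

theorem ae_ne_one (μ : ProbZeroAtOne) : ∀ᵐ α ∂(μ.1 : Measure unitInterval), α ≠ 1 :=
  measure_eq_zero_iff_ae_notMem.1 μ.2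

theorem coe_lt_one_of_ne {α : unitInterval} (h : α ≠ 1) : (α : ℝ) < 1 :=
  lt_of_le_of_ne α.2.2 fun h' => h (Subtype.ext h')

theorem coe_pos_of_ne {α : unitInterval} (h : α ≠ 0) : (0 : ℝ) < α :=
  lt_of_le_of_ne α.2.1 fun h' => h (Subtype.ext h'.symm)

variable {Ω : Type*} [MeasurableSpace Ω] {P : Measure Ω} [IsProbabilityMeasure P]

/-- Fatou's lemma for `ε⁻¹ AV@R_α(Z_ε)` with the spread variables `Z_ε`: the integrals are at most
`lam`, and on `(0,1)` the integrand eventually dominates `(1 - α)⁻¹`. At `α = 0` nonnegativity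
suffices, as `weight` vanishes there. -/
theorem IsKusuokaSet.weight_bound (hP : Nonatomic P) {lam : unitInterval} {M : Set ProbZeroAtOne}
    (hM : IsKusuokaSet P (absSemidev P lam) M) {μ : ProbZeroAtOne} (hμ : μ ∈ M) :
    Integrable weight (μ.1 : Measure unitInterval) ∧
      ∫ α, weight α ∂(μ.1 : Measure unitInterval) ≤ lam := by
  set ν : Measure unitInterval := (μ.1 : Measure unitInterval)
  let ε : ℕ → ℝ := fun n => 1 / ((n : ℝ) + 3)
  have hε0 : ∀ n, 0 < ε n := fun n => by positivity
  have hε1 : ∀ n, ε n < 1 / 2 := fun n => by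
    refine (div_lt_div_iff₀ (by positivity) (by norm_num)).2 ?_
    have : (0 : ℝ) ≤ n := n.cast_nonneg
    linarith
  have hεt : Tendsto ε atTop (𝓝 0) := by
    refine (tendsto_const_nhds (x := (1 : ℝ))).div_atTop ?_
    exact tendsto_atTop_add_const_right _ _ tendsto_natCast_atTop_atTop
  choose Z hZ hmean hrho havar using fun n => hP.exists_spread (lam : ℝ) (hε0 n) (hε1 n)
  let f : ℕ → unitInterval → ℝ := fun n α => (ε n)⁻¹ * avar P α (Z n)
  have hfi : ∀ n, Integrable (f n) ν := fun n => ((hM (Z n) (hZ n)).1 μ hμ).const_mul _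
  have hf0 : ∀ n, 0 ≤ᵐ[ν] f n := fun n => by
    filter_upwards [ae_ne_one μ] with α hα
    have := integral_le_avar (hZ n) α.2.1 (coe_lt_one_of_ne hα)
    rw [hmean n] at this
    exact mul_nonneg (inv_nonneg.2 (hε0 n).le) this
  have hfI : ∀ n, ∫ α, f n α ∂ν ≤ lam := fun n => by
    have h1 : ∫ α : unitInterval, avar P α (Z n) ∂ν ≤ lam * ε n := by
      rw [← hrho n]
      exact (hM (Z n) (hZ n)).2.1 ⟨μ, hμ, rfl⟩
    calc ∫ α, f n α ∂ν = (ε n)⁻¹ * ∫ α : unitInterval, avar P α (Z n) ∂ν :=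
          integral_const_mul _ _
      _ ≤ (ε n)⁻¹ * (lam * ε n) := mul_le_mul_of_nonneg_left h1 (inv_nonneg.2 (hε0 n).le)
      _ = lam := by field_simp [(hε0 n).ne']
  have hwf : ∀ᵐ α ∂ν, ∀ᶠ n in atTop, weight α ≤ f n α := by
    filter_upwards [ae_ne_one μ, ae_all_iff.2 hf0] with α hα hα0
    by_cases h : α = 0
    · subst h
      rw [weight_zero]
      exact Eventually.of_forall hα0
    · filter_upwards [hεt.eventually (ge_mem_nhds (coe_pos_of_ne h)),
        hεt.eventually (ge_mem_nhds (sub_pos.2 (coe_lt_one_of_ne hα)))] with n h1 h2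
      have h3 := mul_le_mul_of_nonneg_left (havar n α h1 (by linarith))
        (inv_nonneg.2 (hε0 n).le)
      rwa [inv_mul_cancel_left₀ (hε0 n).ne', ← weight_of_ne h] at h3
  have hlint : ∫⁻ α, ENNReal.ofReal (weight α) ∂ν ≤ ENNReal.ofReal lam :=
    calc ∫⁻ α, ENNReal.ofReal (weight α) ∂ν
        ≤ ∫⁻ α, liminf (fun n => ENNReal.ofReal (f n α)) atTop ∂ν := by
          refine lintegral_mono_ae ?_
          filter_upwards [hwf] with α hα
          exact le_liminf_of_le (by isBoundedDefault)
            (hα.mono fun n hn => ENNReal.ofReal_le_ofReal hn)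
      _ ≤ liminf (fun n => ∫⁻ α, ENNReal.ofReal (f n α) ∂ν) atTop :=
          lintegral_liminf_le' fun n => (hfi n).aestronglyMeasurable.aemeasurable.ennreal_ofReal
      _ ≤ ENNReal.ofReal lam := by
          refine liminf_le_of_le (by isBoundedDefault) fun b hb => ?_
          obtain ⟨n, hn⟩ := hb.exists
          refine hn.trans ?_
          rw [← ofReal_integral_eq_lintegral_ofReal (hfi n) (hf0 n)]
          exact ENNReal.ofReal_le_ofReal (hfI n)
  refine ⟨⟨measurable_weight.aestronglyMeasurable, ?_⟩, ?_⟩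
  · rw [hasFiniteIntegral_iff_ofReal (Eventually.of_forall weight_nonneg)]
    exact hlint.trans_lt ENNReal.ofReal_lt_top
  · rw [integral_eq_lintegral_of_nonneg_ae (Eventually.of_forall weight_nonneg)
      measurable_weight.aestronglyMeasurable]
    exact ENNReal.toReal_le_of_le_ofReal lam.2.1 hlint

end Weight

/-! ### Concentration at `1 - κ` -/

section Concentration

/-- The defect `κ (1 - κ) - (min κ (1 - α) - κ (1 - α))` of the Brownian bridge covariance. -/
def defect (κ : ℝ) (α : unitInterval) : ℝ :=
  κ * (1 - κ) - (min κ (1 - (α : ℝ)) - κ * (1 - (α : ℝ)))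

theorem continuous_defect (κ : ℝ) : Continuous (defect κ) := by
  unfold defect
  fun_prop

/-- In `s = 1 - α`, the function `min κ s - κ s` is a tent with peak `κ (1 - κ)` at `s = κ`. -/
theorem defect_nonneg {κ : ℝ} (h0 : 0 ≤ κ) (h1 : κ ≤ 1) (α : unitInterval) : 0 ≤ defect κ α := by
  rw [defect]
  rcases le_total κ (1 - (α : ℝ)) with h | h
  · rw [min_eq_left h]; nlinarith
  · rw [min_eq_right h]; nlinarith

theorem eq_of_defect_eq_zero {κ : ℝ} (h0 : 0 < κ) (h1 : κ < 1) {α : unitInterval}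
    (h : defect κ α = 0) : (α : ℝ) = 1 - κ := by
  rw [defect] at h
  rcases le_total κ (1 - (α : ℝ)) with h' | h'
  · rw [min_eq_left h'] at h
    have : κ * (1 - α - κ) = 0 := by linarith
    rcases mul_eq_zero.1 this with h2 | h2 <;> linarith
  · rw [min_eq_right h'] at h
    have : (1 - κ) * (κ - (1 - α)) = 0 := by linarith
    rcases mul_eq_zero.1 this with h2 | h2 <;> linarith

/-- On the compact set `{η ≤ G}` the function `d` is positive, so `G / d` is bounded there. -/
theorem exists_le_add_mul_of_compact {X : Type*} [TopologicalSpace X] [CompactSpace X]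
    {G d : X → ℝ} (hG : Continuous G) (hd : Continuous d) (hd0 : ∀ x, 0 ≤ d x)
    (hGd : ∀ x, d x = 0 → G x = 0) {η : ℝ} (hη : 0 < η) :
    ∃ C, 0 ≤ C ∧ ∀ x, G x ≤ η + C * d x := by
  have hK : IsCompact {x | η ≤ G x} := (isClosed_le continuous_const hG).isCompact
  have hpos : ∀ x ∈ {x | η ≤ G x}, 0 < d x := fun x (hx : η ≤ G x) =>
    (hd0 x).lt_of_ne' fun h => by rw [hGd x h] at hx; linarith
  have hcont : ContinuousOn (fun x => G x / d x) {x | η ≤ G x} :=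
    hG.continuousOn.div hd.continuousOn fun x hx => (hpos x hx).ne'
  obtain ⟨C, hC⟩ := hK.bddAbove_image hcont
  refine ⟨max C 0, le_max_right _ _, fun x => ?_⟩
  have hm : 0 ≤ max C 0 * d x := mul_nonneg (le_max_right _ _) (hd0 x)
  by_cases hx : η ≤ G x
  · have h1 : G x / d x ≤ max C 0 := (hC ⟨x, hx, rfl⟩).trans (le_max_left _ _)
    rw [div_le_iff₀ (hpos x hx)] at h1
    linarith
  · linarith

/-- Measures whose weighted defect from `κ` vanishes and whose weighted mass is asymptotically
maximal converge to `mix lam κ`. -/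
theorem tendsto_mix {lam κ : unitInterval} (hκ : κ ∈ Set.Ioo (0 : unitInterval) 1)
    {μ : ℕ → ProbZeroAtOne}
    (hw : ∀ n, Integrable weight ((μ n).1 : Measure unitInterval))
    (hwl : ∀ n, ∫ α, weight α ∂((μ n).1 : Measure unitInterval) ≤ lam)
    (hlim : Tendsto (fun n => (∫ α, defect κ α * weight α ∂((μ n).1 : Measure unitInterval))
      + κ * (1 - κ) * (lam - ∫ α, weight α ∂((μ n).1 : Measure unitInterval))) atTop (𝓝 0)) :
    Tendsto μ atTop (𝓝 (mix lam κ)) := by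
  have hκ0 : (0 : ℝ) < κ := coe_pos_of_ne hκ.1.ne'
  have hκ1 : (κ : ℝ) < 1 := coe_lt_one_of_ne hκ.2.ne
  have hc : 0 < (κ : ℝ) * (1 - κ) := mul_pos hκ0 (by linarith)
  rw [tendsto_subtype_rng, ProbabilityMeasure.tendsto_iff_forall_integral_tendsto]
  intro f
  -- Chosen so that `F * weight = f - f 0` away from `1`, both sides being zero at `0`.
  let F : unitInterval → ℝ := fun α => (f α - f 0) * (1 - α)
  have hF : Continuous F := by have := f.continuous; fun_prop
  let F₁ : ℝ := F (unitInterval.symm κ)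
  have hF₁ : F₁ = (f (unitInterval.symm κ) - f 0) * κ := by simp [F₁, F]
  have hmix : ∫ α, f α ∂((mix lam κ).1 : Measure unitInterval) = f 0 + lam * F₁ := by
    refine (integral_mixMeasure lam κ f).trans ?_
    rw [hF₁]; ring
  have hbdd : ∀ {g : unitInterval → ℝ}, Continuous g → ∀ n,
      Integrable (fun α => g α * weight α) ((μ n).1 : Measure unitInterval) := by
    intro g hg n
    obtain ⟨C, hC⟩ := isCompact_univ.exists_bound_of_continuousOn hg.continuousOn
    exact (hw n).bdd_mul hg.aestronglyMeasurable
      (Eventually.of_forall fun x => hC x (Set.mem_univ x))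
  have hint : ∀ n, ∫ α, f α ∂((μ n).1 : Measure unitInterval) =
      f 0 + ∫ α, F α * weight α ∂((μ n).1 : Measure unitInterval) := by
    intro n
    have h : ∫ α, f α ∂((μ n).1 : Measure unitInterval) =
        ∫ α, (f 0 + F α * weight α) ∂((μ n).1 : Measure unitInterval) := by
      refine integral_congr_ae ?_
      filter_upwards [ae_ne_one (μ n)] with α hα
      by_cases h0 : α = 0
      · subst h0; simp [weight_zero]
      · have : (1 - (α : ℝ)) ≠ 0 := (sub_pos.2 (coe_lt_one_of_ne hα)).ne'
        simp only [F]
        rw [weight_of_ne h0, mul_assoc, mul_inv_cancel₀ this]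
        ring
    rw [h, integral_add (integrable_const _) (hbdd hF n)]
    simp
  rw [hmix]
  simp_rw [hint]
  refine tendsto_const_nhds.add ?_
  rw [Metric.tendsto_atTop]
  intro δ hδ
  obtain ⟨C, hC0, hC⟩ := exists_le_add_mul_of_compact (G := fun α => |F α - F₁|)
    (d := defect κ) (by fun_prop) (continuous_defect κ) (defect_nonneg κ.2.1 κ.2.2)
    (fun α hα => by
      have : α = unitInterval.symm κ := Subtype.ext (by
        rw [unitInterval.coe_symm_eq]; exact eq_of_defect_eq_zero hκ0 hκ1 hα)
      rw [this]; simp [F₁]) (half_pos hδ)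
  -- The error splits into at most `δ/2 + C D` from the defect and `|F₁| (lam - W)` from the missing
  -- mass; this constant covers both.
  have hlim' := hlim.const_mul (C + |F₁| / (κ * (1 - κ)))
  rw [mul_zero] at hlim'
  obtain ⟨N, hN⟩ := eventually_atTop.1 (hlim'.eventually (gt_mem_nhds (half_pos hδ)))
  refine ⟨N, fun n hn => ?_⟩
  have hn' := hN n hn
  set ν := ((μ n).1 : Measure unitInterval)
  set D := ∫ α, defect κ α * weight α ∂ν
  set W := ∫ α, weight α ∂ν
  have hD0 : 0 ≤ D := integral_nonneg fun α =>
    mul_nonneg (defect_nonneg κ.2.1 κ.2.2 α) (weight_nonneg α)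
  have hWl : 0 ≤ lam - W := sub_nonneg.2 (hwl n)
  have hsplit : (∫ α, F α * weight α ∂ν) - lam * F₁ =
      (∫ α, (F α - F₁) * weight α ∂ν) - F₁ * (lam - W) := by
    have : ∫ α, (F α - F₁) * weight α ∂ν = (∫ α, F α * weight α ∂ν) - F₁ * W := by
      simp_rw [sub_mul]
      rw [integral_sub (hbdd hF n) ((hw n).const_mul F₁), integral_const_mul]
    rw [this]; ring
  have h1 : |∫ α, (F α - F₁) * weight α ∂ν| ≤ δ / 2 * W + C * D := by
    calc |∫ α, (F α - F₁) * weight α ∂ν| ≤ ∫ α, |(F α - F₁) * weight α| ∂ν :=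
          abs_integral_le_integral_abs
      _ ≤ ∫ α, (δ / 2 * weight α + C * (defect κ α * weight α)) ∂ν := by
          refine integral_mono (hbdd (hF.sub continuous_const) n).abs
            (((hw n).const_mul _).add ((hbdd (continuous_defect κ) n).const_mul C)) fun α => ?_
          simp only
          rw [abs_mul, abs_of_nonneg (weight_nonneg α)]
          refine (mul_le_mul_of_nonneg_right (hC α) (weight_nonneg α)).trans_eq ?_
          ring
      _ = δ / 2 * W + C * D := by
          rw [integral_add ((hw n).const_mul _) ((hbdd (continuous_defect κ) n).const_mul C),
            integral_const_mul, integral_const_mul]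
  have h2 : δ / 2 * W ≤ δ / 2 := by
    have : W ≤ 1 := (hwl n).trans lam.2.2
    nlinarith
  have h3 : |F₁ * (lam - W)| = |F₁| / (κ * (1 - κ)) * (κ * (1 - κ) * (lam - W)) := by
    rw [abs_mul, abs_of_nonneg hWl, ← mul_assoc, div_mul_cancel₀ _ hc.ne']
  rw [Real.dist_eq, hsplit]
  have h4 := abs_sub (∫ α, (F α - F₁) * weight α ∂ν) (F₁ * (lam - W))
  have h5 : 0 ≤ C * (κ * (1 - κ) * (lam - W)) := mul_nonneg hC0 (mul_nonneg hc.le hWl)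
  have h6 : 0 ≤ |F₁| / (κ * (1 - κ)) * D := mul_nonneg (div_nonneg (abs_nonneg _) hc.le) hD0
  have h7 : (C + |F₁| / (κ * (1 - κ))) * (D + κ * (1 - κ) * (lam - W)) =
    C * D + C * (κ * (1 - κ) * (lam - W)) + |F₁| / (κ * (1 - κ)) * D
      + |F₁| / (κ * (1 - κ)) * (κ * (1 - κ) * (lam - W)) := by ring
  linarith

end Concentration

/-! ### Minimality -/

section Minimality

variable {Ω : Type*} [MeasurableSpace Ω] {P : Measure Ω} [IsProbabilityMeasure P]

/-- For `α ≠ 0` the right side is `min κ (1 - α) / (1 - α)`; at `α = 0` it is `κ`. -/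
theorem le_add_defect_mul_weight {κ a : ℝ} {α : unitInterval} (hα : α ≠ 1)
    (h1 : a ≤ 1) (h2 : a ≤ (1 - (α : ℝ))⁻¹ * κ) :
    a ≤ κ + (κ * (1 - κ) * weight α - defect κ α * weight α) := by
  by_cases h : α = 0
  · subst h
    simpa [weight_zero] using h2
  · have hpos : 0 < 1 - (α : ℝ) := sub_pos.2 (coe_lt_one_of_ne hα)
    rw [weight_of_ne h, defect]
    have he : κ + (κ * (1 - κ) * (1 - (α : ℝ))⁻¹ - (κ * (1 - κ) -
        (min κ (1 - (α : ℝ)) - κ * (1 - (α : ℝ)))) * (1 - (α : ℝ))⁻¹)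
        = min κ (1 - (α : ℝ)) * (1 - (α : ℝ))⁻¹ := by
      field_simp
      ring
    rw [he]
    rcases min_choice κ (1 - (α : ℝ)) with h' | h' <;> rw [h']
    · rwa [mul_comm]
    · rwa [mul_inv_cancel₀ hpos.ne']

/-- For the indicator of an event of probability `κ`, `ρ Z = κ + lam κ (1 - κ)`, while a measure
with weighted mass `W` and weighted defect `D` yields at most `κ + κ (1 - κ) W - D`. A maximizing
sequence therefore drives `D + κ (1 - κ) (lam - W)` to zero; both terms are nonnegative, the second
by `weight_bound`. -/
theorem IsKusuokaSet.mix_mem_closure (hP : Nonatomic P) {lam : unitInterval}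
    {M : Set ProbZeroAtOne} (hM : IsKusuokaSet P (absSemidev P lam) M) {κ : unitInterval}
    (hκ : κ ∈ Set.Ioo (0 : unitInterval) 1) : mix lam κ ∈ closure M := by
  have hκ0 : (0 : ℝ) < κ := coe_pos_of_ne hκ.1.ne'
  have hκ1 : (κ : ℝ) < 1 := coe_lt_one_of_ne hκ.2.ne
  obtain ⟨Z, hZ, hrho, havar⟩ := hP.exists_indicator (lam : ℝ) hκ0 hκ1
  obtain ⟨hint, hlub⟩ := hM Z hZ
  have hex : ∀ n : ℕ, ∃ μ ∈ M, absSemidev P lam Z - 1 / ((n : ℝ) + 1) <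
      ∫ α : unitInterval, avar P α Z ∂(μ.1 : Measure unitInterval) := by
    intro n
    have hn : 0 < 1 / ((n : ℝ) + 1) := by positivity
    obtain ⟨_, ⟨μ, hμ, rfl⟩, h⟩ := (lt_isLUB_iff hlub).1 (sub_lt_self (absSemidev P lam Z) hn)
    exact ⟨μ, hμ, h⟩
  choose μ hμM hμ using hex
  have hw := fun n => (hM.weight_bound hP (hμM n)).1
  have hwl := fun n => (hM.weight_bound hP (hμM n)).2
  refine mem_closure_of_tendsto (tendsto_mix hκ hw hwl ?_) (Eventually.of_forall hμM)
  refine squeeze_zero (fun n => ?_) (fun n => ?_) tendsto_one_div_add_atTop_nhds_zero_nat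
  · exact add_nonneg
      (integral_nonneg fun α => mul_nonneg (defect_nonneg κ.2.1 κ.2.2 α) (weight_nonneg α))
      (mul_nonneg (mul_nonneg κ.2.1 (by linarith)) (sub_nonneg.2 (hwl n)))
  · have hdw : Integrable (fun α => defect κ α * weight α) ((μ n).1 : Measure unitInterval) := by
      obtain ⟨C, hC⟩ :=
        isCompact_univ.exists_bound_of_continuousOn (continuous_defect κ).continuousOn
      exact (hw n).bdd_mul (continuous_defect κ).aestronglyMeasurable
        (Eventually.of_forall fun x => hC x (Set.mem_univ x))
    have hi : Integrable (fun α => (κ : ℝ) * (1 - κ) * weight α - defect κ α * weight α)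
        ((μ n).1 : Measure unitInterval) := ((hw n).const_mul ((κ : ℝ) * (1 - κ))).sub hdw
    have hle : ∫ α : unitInterval, avar P α Z ∂((μ n).1 : Measure unitInterval) ≤
        ∫ α, ((κ : ℝ) + ((κ : ℝ) * (1 - κ) * weight α - defect κ α * weight α))
          ∂((μ n).1 : Measure unitInterval) := by
      refine integral_mono_ae (hint _ (hμM n)) ((integrable_const _).add hi) ?_
      filter_upwards [ae_ne_one (μ n)] with α hα
      obtain ⟨h1, h2⟩ := havar α α.2.1 (coe_lt_one_of_ne hα)
      exact le_add_defect_mul_weight hα h1 h2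
    rw [integral_add (integrable_const _) hi,
      integral_sub ((hw n).const_mul ((κ : ℝ) * (1 - κ))) hdw, integral_const_mul] at hle
    simp only [integral_const, probReal_univ, smul_eq_mul, one_mul] at hle
    have := hμ n
    rw [hrho] at this
    linarith

end Minimality

end Kusuoka
end

theorem mainTheorem11 {Ω : Type*} [MeasurableSpace Ω] (P : Measure Ω) [IsProbabilityMeasure P]
    (hP : Kusuoka.Nonatomic P) (lam : unitInterval) :
    (∀ Z : Ω → ℝ, Integrable Z P →
      IsLUB (Set.range fun κ : unitInterval =>
        (1 - (lam : ℝ) * κ) * Kusuoka.avar P 0 Z + lam * κ * Kusuoka.avar P (1 - κ) Z)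
        (Kusuoka.absSemidev P lam Z) ∧
      Kusuoka.avar P 0 Z = ∫ ω, Z ω ∂P) ∧
    Kusuoka.IsKusuokaSet P (Kusuoka.absSemidev P lam) (Kusuoka.mix lam '' Set.Ioo 0 1) ∧
    closure (Kusuoka.mix lam '' Set.Ioo 0 1) = Set.range (Kusuoka.mix lam) ∧
    Kusuoka.IsMinimalKusuokaSet P (Kusuoka.absSemidev P lam)
      (closure (Kusuoka.mix lam '' Set.Ioo 0 1)) := by
  refine ⟨fun Z hZ => ⟨?_, Kusuoka.avar_zero hZ⟩,
    Kusuoka.isKusuokaSet_image_mix P lam subset_rfl, Kusuoka.closure_image_mix lam,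
    isClosed_closure, ?_, fun M' hM' hK => closure_minimal ?_ hM'⟩
  · rw [← Set.image_univ]
    exact Kusuoka.isLUB_mix_value hZ lam (Set.subset_univ _)
  · rw [Kusuoka.closure_image_mix, ← Set.image_univ]
    exact Kusuoka.isKusuokaSet_image_mix P lam (Set.subset_univ _)
  · rintro _ ⟨κ, hκ, rfl⟩
    rw [← hM'.closure_eq]
    exact hK.mix_mem_closure hP hκ
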